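/- Let $H$ be a separable real Hilbert space and $X$ a random variable with values in $H$. Assume: (A1) for every $h\in H$ there is $h'\in H$ with $\langle h,h'\rangle=0$ and $\operatorname{Var}(\langle X,h'\rangle)>0$ (the variance being allowed to be $+\infty$); (A2) there is a constant $C>0$ such that for all $h\in H$, $\mathbb E\left[\frac1{\|X-h\|}\right]\le C$ and $\mathbb E\left[\frac1{\|X-h\|^2}\right]\le C$ (with $1/0=+\infty$). Let $m$ be the geometric median of $X$, that is, the minimizer over $h\in H$ of $\mathbb E\left[\|X-h\|-\|X\|\right]$. Let $X_1,X_2,\dots$ be independent random variables with the same law as $X$, let $\gamma_n=c_\gamma n^{-\alpha}$ with $c_\gamma>0$ and $\alpha\in(1/2,1)$, and define the Robbins–Monro estimator by $$Z_{n+1}=Z_n+\gamma_n\frac{X_{n+1}-Z_n}{\|X_{n+1}-Z_n\|},\qquad n\ge1,$$ (the quotient being read as $0$ if $X_{n+1}=Z_n$), where $Z_1$ is an almost surely bounded random variable independent of $(X_n)_{n\ge2}$ (for instance deterministic, or a bounded measurable function of $X_1$). Then for every real $p\ge1$ there is a constant $K_p>0$ such that for all $n\ge1$, $$\mathbb E\left[\|Z_n-m\|^{2p}\right]\le\frac{K_p}{n^{p\alpha}},$$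 and, with the same $K_p$, for all $n\ge1$, $$\mathbb E\left[\|Z_n-m\|^{p}\right]\le\frac{\sqrt{K_p}}{n^{p\alpha/2}}.$$ -/

import Mathlib

open MeasureTheory ProbabilityTheory

/-- The objective `G(h) = E[‖X - h‖ - ‖X‖]`. The integrand is bounded by `‖h‖`, so no moment of `X`
is needed. -/
noncomputable def medianObjective {Ω H : Type*} [MeasurableSpace Ω] [NormedAddCommGroup H]
    (P : Measure Ω) (X : Ω → H) (h : H) : ℝ :=
  ∫ ω, (‖X ω - h‖ - ‖X ω‖) ∂P

/-- `m` is a geometric median of `X`: it minimizes `h ↦ E[‖X - h‖ - ‖X‖]` over the whole space. -/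
def IsGeometricMedian {Ω H : Type*} [MeasurableSpace Ω] [NormedAddCommGroup H]
    (P : Measure Ω) (X : Ω → H) (m : H) : Prop :=
  ∀ h : H, medianObjective P X m ≤ medianObjective P X h

/-- `X` is not concentrated on a straight line: every `h` has an orthogonal `h'` such that
`⟨X, h'⟩` has positive variance. The variance takes values in `[0, ∞]`, as `X` need not have
moments. -/
def NotConcentratedOnLine {Ω H : Type*} [MeasurableSpace Ω] [NormedAddCommGroup H]
    [InnerProductSpace ℝ H] (P : Measure Ω) (X : Ω → H) : Prop :=
  ∀ h : H, ∃ h' : H, inner ℝ h h' = 0 ∧ 0 < evariance (fun ω => inner ℝ (X ω) h') P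

/-- `X` is not concentrated around single points: `E[1 / ‖X - h‖]` and `E[1 / ‖X - h‖ ^ 2]` are
bounded by one constant, uniformly in `h`. Expectations are in `[0, ∞]`, with `1 / 0 = ∞`. -/
def NotConcentratedAroundPoints {Ω H : Type*} [MeasurableSpace Ω] [NormedAddCommGroup H]
    (P : Measure Ω) (X : Ω → H) : Prop :=
  ∃ C : ℝ, 0 < C ∧ ∀ h : H,
    ∫⁻ ω, ‖X ω - h‖ₑ⁻¹ ∂P ≤ ENNReal.ofReal C ∧
    ∫⁻ ω, (‖X ω - h‖ₑ ^ 2)⁻¹ ∂P ≤ ENNReal.ofReal C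

/-- `Z 1, Z 2, …` is the Robbins–Monro estimator built on the observations `X 1, X 2, …` with
steps `γ 1, γ 2, …`; the values at index `0` play no role. The initialization `Z 1` is bounded
and independent of the observations `X 2, X 3, …` used in the recursion: it may be deterministic,
or a bounded function of `X 1`. -/
structure IsRobbinsMonro {Ω H : Type*} [MeasurableSpace Ω] [NormedAddCommGroup H]
    [InnerProductSpace ℝ H] [MeasurableSpace H]
    (P : Measure Ω) (X : ℕ → Ω → H) (γ : ℕ → ℝ) (Z : ℕ → Ω → H) : Prop where
  measurable_init : Measurable (Z 1)
  bounded_init : ∃ M : ℝ, ∀ᵐ ω ∂P, ‖Z 1 ω‖ ≤ M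
  indep_init : IndepFun (Z 1) (fun ω (k : ℕ) => X (k + 2) ω) P
  step : ∀ n : ℕ, 1 ≤ n → ∀ ω,
    Z (n + 1) ω = Z n ω + γ n • (‖X (n + 1) ω - Z n ω‖⁻¹ • (X (n + 1) ω - Z n ω))

/-!
Write `V n = Z n - m`, `W n = ‖V n‖ ^ 2` and let `U` be the unit vector used in the `n`-th step.
Since `‖U‖ ≤ 1`,
`W (n + 1) ≤ W n + 2 γₙ ⟪V n, U⟫ + γₙ ^ 2`,
and the observation entering `U` is independent of `Z n`, so everything rests on a lower bound for
the drift `-E⟪h - m, (X - h) / ‖X - h‖⟫`, for a fixed `h`.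

**Drift.** For `y = X - m` and `v = h - m`, the subgradient inequality
`⟪v, (y - v) / ‖y - v‖⟫ ≤ ‖y‖ - ‖y - v‖` holds up to the defect `‖y‖ (1 - cos θ)`, where `θ` is the
angle between `y` and `y - v`. The expectation of the right-hand side is at most `0` because `m` is
a minimizer. The defect is at least `min 1 (‖v‖ ^ 2)` times a weighted squared component
`⟪y, d⟫ ^ 2 / (2 ‖d‖ ^ 2 (1 + ‖y‖) ^ 3)` of `y` along any direction `d` orthogonal to `v`
(`inner_unit_le`). As `X` is not concentrated on a line, its weighted second moment form about `m`
is positive definite on some plane (`exists_weight_orthogonal_pair`). This plane contains a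
direction orthogonal to any given `v`, so that the drift is at least `c * min 1 (‖h - m‖ ^ 2)` with
`c` independent of `h` (`exists_drift`).

**Moments.** Expanding powers (`exists_quadratic_pow_succ_le`) gives
`E W(n+1)^(q+1) ≤ E W(n)^(q+1) - κ γₙ E[W(n)^q min(1, W(n))] + C γₙ² (E W(n)^q + γₙ^(2q))`.
Ignoring the drift, and since `∑ γₙ ^ 2 < ∞`, all moments are bounded, by induction on `q`. Now
`W^q min(1, W) ≥ W^(q+1) / T - W^(q+1+M) / T^(M+1)` for every `T ≥ 1`. With `T = n ^ δ`, `δ > 0`,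
and `M` large, the bounded moments make the last term negligible, and the recursion yields
`E W(n)^q = O(n ^ (-q (α - δ)))` for all `q`. These rates for large powers make the
last term negligible with `T = 1` also, so that a second pass yields `E W(n)^q = O(n ^ (-q α))`
(`exists_moment_rate`). Real exponents follow by comparison with a larger integer.
-/

/-! ### Real recursions -/

/-- `(1 + 1/n)⁻ᵗ ≥ 1 - t/n`, multiplied by `n⁻ᵗ`. -/
lemma rpow_neg_mul_one_sub_le {t : ℝ} (ht : 0 ≤ t) {n : ℕ} (hn : 1 ≤ n) :
    (n : ℝ) ^ (-t) * (1 - t / n) ≤ ((n + 1 : ℕ) : ℝ) ^ (-t) := by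
  have hn0 : (0 : ℝ) < n := by exact_mod_cast hn
  have h := Real.one_sub_le_exp_neg (t / n)
  have h1 : Real.log (1 + 1 / n) ≤ 1 / n := by
    have := Real.log_le_sub_one_of_pos (show (0:ℝ) < 1 + 1 / n by positivity)
    linarith
  have h2 : Real.exp (-(t / n)) ≤ (1 + 1 / (n : ℝ)) ^ (-t) := by
    rw [Real.rpow_def_of_pos (by positivity)]
    apply Real.exp_le_exp.2
    have := mul_le_mul_of_nonneg_left h1 ht
    rw [mul_one_div] at this
    linarith
  calc (n : ℝ) ^ (-t) * (1 - t / n) ≤ (n : ℝ) ^ (-t) * (1 + 1 / (n : ℝ)) ^ (-t) := by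
        gcongr
        linarith
    _ = ((n + 1 : ℕ) : ℝ) ^ (-t) := by
        rw [← Real.mul_rpow hn0.le (by positivity)]
        congr 1
        push_cast
        field_simp

/-- A nonnegative sequence that contracts by the factor `1 - c n⁻ˢ` with `s < 1`, up to an error of
order `n⁻ˢ⁻ᵗ`, is of order `n⁻ᵗ`: the contraction outweighs the decay `1 - t/n` of `n⁻ᵗ`. -/
lemma exists_le_rpow_of_recursion {a : ℕ → ℝ} {s t c C : ℝ} (hs1 : s < 1) (ht : 0 ≤ t)
    (hs0 : 0 < s) (hc : 0 < c) (hC : 0 ≤ C) (ha : ∀ n, 0 ≤ a n)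
    (h : ∀ n : ℕ, 1 ≤ n →
      a (n + 1) ≤ (1 - c * (n : ℝ) ^ (-s)) * a n + C * (n : ℝ) ^ (-(s + t))) :
    ∃ K : ℝ, 0 < K ∧ ∀ n : ℕ, 1 ≤ n → a n ≤ K * (n : ℝ) ^ (-t) := by
  have e1 : ∀ᶠ n : ℕ in Filter.atTop, c * (n : ℝ) ^ (-s) ≤ 1 := by
    have := ((tendsto_rpow_neg_atTop hs0).comp tendsto_natCast_atTop_atTop).const_mul c
    rw [mul_zero] at this
    exact this.eventually_le_const one_pos
  have e2 : ∀ᶠ n : ℕ in Filter.atTop, 2 * t / c ≤ (n : ℝ) ^ (1 - s) :=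
    ((tendsto_rpow_atTop (sub_pos.2 hs1)).comp
      tendsto_natCast_atTop_atTop).eventually_ge_atTop (2 * t / c)
  obtain ⟨N, hN⟩ := Filter.eventually_atTop.1 (e1.and e2)
  have hS : 0 ≤ ∑ k ∈ Finset.range (N + 2), a k * (k : ℝ) ^ t :=
    Finset.sum_nonneg fun k _ => mul_nonneg (ha k) (by positivity)
  set K := ∑ k ∈ Finset.range (N + 2), a k * (k : ℝ) ^ t + 2 * C / c + 1 with hK
  have hCc : 0 ≤ 2 * C / c := by positivity
  have hK0 : 0 < K := by linarith
  refine ⟨K, hK0, fun n hn => ?_⟩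
  induction n, hn using Nat.le_induction with
  | base =>
    have := Finset.single_le_sum (f := fun k : ℕ => a k * (k : ℝ) ^ t)
      (fun k _ => mul_nonneg (ha k) (by positivity)) (Finset.mem_range.2 (show 1 < N + 2 by omega))
    simp only [Nat.cast_one, Real.one_rpow, mul_one] at this ⊢
    linarith
  | succ n hn ih =>
    have hn0 : (0 : ℝ) < n := by exact_mod_cast hn
    by_cases hnN : n < N
    · have := Finset.single_le_sum (f := fun k : ℕ => a k * (k : ℝ) ^ t)
        (fun k _ => mul_nonneg (ha k) (by positivity))
        (Finset.mem_range.2 (show n + 1 < N + 2 by omega))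
      rw [Real.rpow_neg (by positivity), ← div_eq_mul_inv, le_div_iff₀ (by positivity)]
      linarith
    · obtain ⟨h1, h2⟩ := hN n (not_lt.1 hnN)
      refine (h n hn).trans (le_trans ?_
        (mul_le_mul_of_nonneg_left (rpow_neg_mul_one_sub_le ht hn) hK0.le))
      have h3 := mul_le_mul_of_nonneg_left ih (sub_nonneg.2 h1)
      have hst : (n : ℝ) ^ (-(s + t)) = (n : ℝ) ^ (-s) * (n : ℝ) ^ (-t) := by
        rw [← Real.rpow_add hn0]; congr 1; ring
      have h1s : (n : ℝ) ^ (1 - s) = n * (n : ℝ) ^ (-s) := by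
        rw [sub_eq_add_neg, Real.rpow_add hn0, Real.rpow_one]
      have h4 : 2 * C ≤ K * c := by
        have : 2 * C / c ≤ K := by linarith
        rwa [div_le_iff₀ hc] at this
      have h5 : 2 * (t / n) ≤ c * (n : ℝ) ^ (-s) := by
        rw [h1s, div_le_iff₀ hc] at h2
        rw [← mul_div_assoc, div_le_iff₀ hn0]
        linarith
      have hy : 0 < (n : ℝ) ^ (-s) := by positivity
      have hz : 0 < (n : ℝ) ^ (-t) := by positivity
      rw [hst]
      generalize (n : ℝ) ^ (-s) = y at *
      generalize (n : ℝ) ^ (-t) = z at *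
      have h6 : C * y + K * (t / n) ≤ K * (c * y) := by nlinarith
      have := mul_le_mul_of_nonneg_right h6 hz.le
      linear_combination h3 + this

lemma exists_bound_of_le_add {a b : ℕ → ℝ} (hb : Summable b) (hb0 : ∀ n, 0 ≤ b n)
    (h : ∀ n : ℕ, 1 ≤ n → a (n + 1) ≤ a n + b n) : ∃ K : ℝ, 0 ≤ K ∧ ∀ n : ℕ, 1 ≤ n → a n ≤ K := by
  have key : ∀ n : ℕ, 1 ≤ n → a n ≤ a 1 + ∑ k ∈ Finset.range n, b k := by
    intro n hn
    induction n, hn using Nat.le_induction with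
    | base => simpa using hb0 0
    | succ n hn ih =>
      rw [Finset.sum_range_succ]
      linarith [h n hn]
  refine ⟨|a 1| + ∑' k, b k, add_nonneg (abs_nonneg _) (tsum_nonneg hb0), fun n hn => ?_⟩
  exact (key n hn).trans (add_le_add (le_abs_self _) (hb.sum_le_tsum _ fun k _ => hb0 k))

/-- One pass of the bootstrap, with the truncation level `T = n ^ δ`: if high moments are small
enough for the truncation error `a (q + 1 + M) n / T ^ (M + 1)` to be negligible, then `a q n` is of
order `n ^ (-q (α - δ))`. Here `a q n` stands for the moment of order `2 q` of `‖Z n - m‖`. -/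
lemma exists_moment_rate_step {a : ℕ → ℕ → ℝ} {cγ α δ : ℝ} (hcγ : 0 < cγ) (hα : 0 < α) (hδ : 0 ≤ δ)
    (hαδ : α + δ < 1) (hδα : δ ≤ α) (ha : ∀ q n, 0 ≤ a q n) (ha0 : ∀ n, a 0 n ≤ 1)
    (hrec : ∀ q : ℕ, ∃ κ : ℝ, 0 < κ ∧ ∃ C : ℝ, 0 ≤ C ∧ ∀ n : ℕ, 1 ≤ n → ∀ T : ℝ, 1 ≤ T → ∀ M : ℕ,
      a (q + 1) (n + 1) ≤ a (q + 1) n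
        - κ * (cγ * (n : ℝ) ^ (-α)) * (a (q + 1) n / T - a (q + 1 + M) n / T ^ (M + 1))
        + C * (cγ * (n : ℝ) ^ (-α)) ^ 2 * (a q n + ((cγ * (n : ℝ) ^ (-α)) ^ 2) ^ q))
    (htail : ∀ q : ℕ, ∃ M : ℕ, ∃ K : ℝ, 0 ≤ K ∧ ∀ n : ℕ, 1 ≤ n →
      a (q + 1 + M) n ≤ K * (n : ℝ) ^ (δ * M - (q + 1) * (α - δ))) (q : ℕ) :
    ∃ K : ℝ, 0 < K ∧ ∀ n : ℕ, 1 ≤ n → a q n ≤ K * (n : ℝ) ^ (-(q * (α - δ))) := by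
  induction q with
  | zero => exact ⟨1, one_pos, fun n _ => by simpa using ha0 n⟩
  | succ q ih =>
    obtain ⟨K, hK, hKn⟩ := ih
    obtain ⟨κ, hκ, C, hC, hrec⟩ := hrec q
    obtain ⟨M, L, hL, hLn⟩ := htail q
    refine exists_le_rpow_of_recursion (s := α + δ) (t := (q + 1 : ℕ) * (α - δ)) (c := κ * cγ)
      (C := κ * cγ * L + C * cγ ^ 2 * (K + (cγ ^ 2) ^ q)) hαδ
      (mul_nonneg (by positivity) (sub_nonneg.2 hδα)) (by linarith) (by positivity)
      (by positivity) (ha _) fun n hn => ?_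
    have hn1 : (1 : ℝ) ≤ n := by exact_mod_cast hn
    have hn0 : (0 : ℝ) < n := by linarith
    have h := hrec n hn ((n : ℝ) ^ δ) (Real.one_le_rpow hn1 hδ) M
    set e : ℝ := α + δ + (q + 1 : ℕ) * (α - δ) with he
    have r1 : (n : ℝ) ^ (-α) / (n : ℝ) ^ δ = (n : ℝ) ^ (-(α + δ)) := by
      rw [← Real.rpow_sub hn0]; congr 1; ring
    have r2 : (n : ℝ) ^ (-α) * (a (q + 1 + M) n / ((n : ℝ) ^ δ) ^ (M + 1)) ≤ L * (n : ℝ) ^ (-e) := by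
      have : (n : ℝ) ^ (-α) * ((L * (n : ℝ) ^ (δ * M - (q + 1) * (α - δ)))
          / ((n : ℝ) ^ δ) ^ (M + 1)) = L * (n : ℝ) ^ (-e) := by
        rw [← Real.rpow_mul_natCast hn0.le, mul_div_assoc, ← Real.rpow_sub hn0, mul_left_comm,
          ← Real.rpow_add hn0]
        congr 2
        rw [he]; push_cast; ring
      rw [← this]
      gcongr
      exact hLn n hn
    have r3 : ((n : ℝ) ^ (-α)) ^ 2 * a q n ≤ K * (n : ℝ) ^ (-e) := by
      have : ((n : ℝ) ^ (-α)) ^ 2 * (K * (n : ℝ) ^ (-(q * (α - δ)))) = K * (n : ℝ) ^ (-e) := by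
        rw [← Real.rpow_mul_natCast hn0.le, mul_left_comm, ← Real.rpow_add hn0]
        congr 2
        rw [he]; push_cast; ring
      rw [← this]
      gcongr
      exact hKn n hn
    have r4 : ((n : ℝ) ^ (-α)) ^ 2 * (((n : ℝ) ^ (-α)) ^ 2) ^ q ≤ (n : ℝ) ^ (-e) := by
      rw [← pow_succ', ← Real.rpow_mul_natCast hn0.le, ← Real.rpow_mul_natCast hn0.le]
      apply Real.rpow_le_rpow_of_exponent_le hn1
      rw [he]; push_cast
      have : 0 ≤ (q : ℝ) * (α + δ) := by positivity
      linarith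
    have e1 : a (q + 1) n
        - κ * (cγ * (n : ℝ) ^ (-α)) * (a (q + 1) n / (n : ℝ) ^ δ
          - a (q + 1 + M) n / ((n : ℝ) ^ δ) ^ (M + 1))
        + C * (cγ * (n : ℝ) ^ (-α)) ^ 2 * (a q n + ((cγ * (n : ℝ) ^ (-α)) ^ 2) ^ q)
        = (1 - κ * cγ * ((n : ℝ) ^ (-α) / (n : ℝ) ^ δ)) * a (q + 1) n
        + κ * cγ * ((n : ℝ) ^ (-α) * (a (q + 1 + M) n / ((n : ℝ) ^ δ) ^ (M + 1)))
        + C * cγ ^ 2 * (((n : ℝ) ^ (-α)) ^ 2 * a q n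
          + (cγ ^ 2) ^ q * (((n : ℝ) ^ (-α)) ^ 2 * (((n : ℝ) ^ (-α)) ^ 2) ^ q)) := by
      rw [mul_pow cγ, mul_pow (cγ ^ 2)]
      ring
    rw [e1, r1] at h
    have g1 := mul_le_mul_of_nonneg_left r2 (by positivity : 0 ≤ κ * cγ)
    have g2 := mul_le_mul_of_nonneg_left
      (add_le_add r3 (mul_le_mul_of_nonneg_left r4 (by positivity : 0 ≤ (cγ ^ 2) ^ q)))
      (by positivity : 0 ≤ C * cγ ^ 2)
    linarith

/-- Even without any drift the moments stay bounded, as the squared steps are summable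
(`2 α > 1`). -/
lemma exists_moment_bound {a : ℕ → ℕ → ℝ} {cγ α : ℝ} (hα : 1 / 2 < α)
    (ha0 : ∀ n, a 0 n ≤ 1)
    (hgrow : ∀ q : ℕ, ∃ C : ℝ, 0 ≤ C ∧ ∀ n : ℕ, 1 ≤ n →
      a (q + 1) (n + 1) ≤ a (q + 1) n
        + C * (cγ * (n : ℝ) ^ (-α)) ^ 2 * (a q n + ((cγ * (n : ℝ) ^ (-α)) ^ 2) ^ q)) (q : ℕ) :
    ∃ K : ℝ, 0 ≤ K ∧ ∀ n : ℕ, 1 ≤ n → a q n ≤ K := by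
  induction q with
  | zero => exact ⟨1, zero_le_one, fun n _ => ha0 n⟩
  | succ q ih =>
    obtain ⟨K, hK, hKn⟩ := ih
    obtain ⟨C, hC, hgrow⟩ := hgrow q
    have hs : Summable fun n : ℕ =>
        C * cγ ^ 2 * (K + (cγ ^ 2) ^ q) * (n : ℝ) ^ (-(2 * α)) :=
      (Real.summable_nat_rpow.2 (by linarith)).mul_left _
    refine exists_bound_of_le_add hs (fun n => by positivity) fun n hn => ?_
    have hn1 : (1 : ℝ) ≤ n := by exact_mod_cast hn
    have hn0 : (0 : ℝ) < n := by linarith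
    refine (hgrow n hn).trans ?_
    have hy : (n : ℝ) ^ (-α) ≤ 1 := Real.rpow_le_one_of_one_le_of_nonpos hn1 (by linarith)
    have hy0 : 0 ≤ (n : ℝ) ^ (-α) := by positivity
    have h1 : ((cγ * (n : ℝ) ^ (-α)) ^ 2) ^ q ≤ (cγ ^ 2) ^ q := by
      rw [mul_pow]
      gcongr
      exact mul_le_of_le_one_right (sq_nonneg _) (pow_le_one₀ hy0 hy)
    have h2 : (n : ℝ) ^ (-(2 * α)) = ((n : ℝ) ^ (-α)) ^ 2 := by
      rw [← Real.rpow_mul_natCast hn0.le]; congr 1; push_cast; ring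
    rw [h2]
    have := mul_le_mul_of_nonneg_left (add_le_add (hKn n hn) h1)
      (by positivity : 0 ≤ C * (cγ * (n : ℝ) ^ (-α)) ^ 2)
    linarith

/-- The rate for all integer moments, by two passes of `exists_moment_rate_step`: a first one with
`δ > 0` based on the boundedness of the moments, a second one with `δ = 0` based on the rates
obtained in the first. -/
lemma exists_moment_rate {a : ℕ → ℕ → ℝ} {cγ α : ℝ} (hcγ : 0 < cγ) (hα : α ∈ Set.Ioo (1 / 2 : ℝ) 1)
    (ha : ∀ q n, 0 ≤ a q n) (ha0 : ∀ n, a 0 n ≤ 1)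
    (hgrow : ∀ q : ℕ, ∃ C : ℝ, 0 ≤ C ∧ ∀ n : ℕ, 1 ≤ n →
      a (q + 1) (n + 1) ≤ a (q + 1) n
        + C * (cγ * (n : ℝ) ^ (-α)) ^ 2 * (a q n + ((cγ * (n : ℝ) ^ (-α)) ^ 2) ^ q))
    (hrec : ∀ q : ℕ, ∃ κ : ℝ, 0 < κ ∧ ∃ C : ℝ, 0 ≤ C ∧ ∀ n : ℕ, 1 ≤ n → ∀ T : ℝ, 1 ≤ T → ∀ M : ℕ,
      a (q + 1) (n + 1) ≤ a (q + 1) n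
        - κ * (cγ * (n : ℝ) ^ (-α)) * (a (q + 1) n / T - a (q + 1 + M) n / T ^ (M + 1))
        + C * (cγ * (n : ℝ) ^ (-α)) ^ 2 * (a q n + ((cγ * (n : ℝ) ^ (-α)) ^ 2) ^ q)) (q : ℕ) :
    ∃ K : ℝ, 0 < K ∧ ∀ n : ℕ, 1 ≤ n → a q n ≤ K * (n : ℝ) ^ (-(q * α)) := by
  obtain ⟨hα1, hα2⟩ := hα
  -- The first pass uses `δ = (1 - α) / 2`; any `0 < δ < min α (1 - α)` would do.
  have hδ : 0 < (1 - α) / 2 := by linarith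
  have hβ : 0 < α - (1 - α) / 2 := by linarith
  have hslow := exists_moment_rate_step hcγ (by linarith) hδ.le (by linarith) (by linarith) ha ha0
    hrec fun q => by
      obtain ⟨M, hM⟩ := exists_nat_ge ((q + 1) * (α - (1 - α) / 2) / ((1 - α) / 2))
      obtain ⟨K, hK, hKn⟩ := exists_moment_bound hα1 ha0 hgrow (q + 1 + M)
      refine ⟨M, K, hK, fun n hn => (hKn n hn).trans (le_mul_of_one_le_right hK ?_)⟩
      rw [div_le_iff₀ hδ] at hM
      exact Real.one_le_rpow (by exact_mod_cast hn) (by linarith)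
  have hfast := exists_moment_rate_step hcγ (by linarith) le_rfl (by linarith) (by linarith) ha ha0
    hrec fun q => by
      obtain ⟨M, hM⟩ := exists_nat_ge ((q + 1) * α / (α - (1 - α) / 2))
      obtain ⟨K, hK, hKn⟩ := hslow (q + 1 + M)
      refine ⟨M, K, hK.le, fun n hn => (hKn n hn).trans ?_⟩
      rw [div_le_iff₀ hβ] at hM
      gcongr
      · exact_mod_cast hn
      · push_cast
        have : 0 ≤ ((q : ℝ) + 1) * (α - (1 - α) / 2) := by positivity
        linarith
  simpa using hfast q

/-! ### Elementary inequalities for powers -/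

/-- First order expansion of `‖x + g u‖ ^ (2 (q + 1))` in `g`, where `r = ‖x‖`, `s = ⟪x, u⟫` and
`‖u‖ ≤ 1`. -/
lemma exists_quadratic_pow_succ_le (q : ℕ) : ∃ C : ℝ, 0 ≤ C ∧ ∀ r g s : ℝ, 0 ≤ r → 0 ≤ g → |s| ≤ r →
    (r ^ 2 + 2 * g * s + g ^ 2) ^ (q + 1) ≤
      (r ^ 2) ^ (q + 1) + 2 * (q + 1) * g * s * (r ^ 2) ^ q
        + C * g ^ 2 * ((r ^ 2) ^ q + (g ^ 2) ^ q) := by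
  induction q with
  | zero => exact ⟨1, by norm_num, fun r g s _ _ _ => by norm_num; nlinarith [sq_nonneg g]⟩
  | succ q ih =>
    obtain ⟨C, hC, h⟩ := ih
    refine ⟨4 * C + 8 * (q + 1) + 2, by positivity, fun r g s hr hg hs => ?_⟩
    have h1 := h r g s hr hg hs
    obtain ⟨hs1, hs2⟩ := abs_le.1 hs
    have hgs : g * s ≤ g * r := mul_le_mul_of_nonneg_left hs2 hg
    have hgs' : -(g * r) ≤ g * s := by nlinarith
    have hQ0 : 0 ≤ r ^ 2 + 2 * g * s + g ^ 2 := by nlinarith [sq_nonneg (r - g)]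
    have hQ1 : r ^ 2 + 2 * g * s + g ^ 2 ≤ 2 * (r ^ 2 + g ^ 2) := by nlinarith [sq_nonneg (r - g)]
    have hs3 : s ^ 2 ≤ r ^ 2 := sq_le_sq' hs1 hs2
    have h2 := mul_le_mul_of_nonneg_left h1 hQ0
    have hx : 0 ≤ (r ^ 2) ^ q := by positivity
    have hz : 0 ≤ (g ^ 2) ^ q := by positivity
    -- Chebyshev's inequality for the similarly ordered pairs `(r², g²)` and `(r²ᵠ, g²ᵠ)`.
    have hch : 0 ≤ (r ^ 2 - g ^ 2) * ((r ^ 2) ^ q - (g ^ 2) ^ q) := by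
      rcases le_total (r ^ 2) (g ^ 2) with hle | hle
      · exact mul_nonneg_of_nonpos_of_nonpos (sub_nonpos.2 hle)
          (sub_nonpos.2 (pow_le_pow_left₀ (sq_nonneg r) hle q))
      · exact mul_nonneg (sub_nonneg.2 hle)
          (sub_nonneg.2 (pow_le_pow_left₀ (sq_nonneg g) hle q))
    have e1 : (r ^ 2 + 2 * g * s + g ^ 2) ^ (q + 1 + 1) =
      (r ^ 2 + 2 * g * s + g ^ 2) * (r ^ 2 + 2 * g * s + g ^ 2) ^ (q + 1) := by ring
    rw [e1]
    refine h2.trans ?_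
    simp only [pow_succ (r ^ 2), pow_succ (g ^ 2)]
    push_cast
    generalize (r ^ 2) ^ q = x at *
    generalize (g ^ 2) ^ q = z at *
    have b0 : (r ^ 2 + g ^ 2) * (x + z) ≤ 2 * (x * r ^ 2 + z * g ^ 2) := by nlinarith
    have b1 : (r ^ 2 + 2 * g * s + g ^ 2) * (x + z) ≤ 4 * (x * r ^ 2 + z * g ^ 2) := by
      nlinarith [mul_le_mul_of_nonneg_right hQ1 (add_nonneg hx hz)]
    have b2 : 4 * s ^ 2 * x + 2 * (g * s) * x ≤ 8 * (x * r ^ 2 + z * g ^ 2) := by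
      have : 2 * (g * s) ≤ r ^ 2 + g ^ 2 := by nlinarith [sq_nonneg (r - g)]
      have h4 := mul_le_mul_of_nonneg_right this hx
      have h5 := mul_le_mul_of_nonneg_right hs3 hx
      have h6 : 0 ≤ (r ^ 2 + g ^ 2) * z := by positivity
      have h7 : 0 ≤ g ^ 2 * z := by positivity
      nlinarith
    have b3 : r ^ 2 * x ≤ 2 * (x * r ^ 2 + z * g ^ 2) := by
      have h7 : 0 ≤ g ^ 2 * z := by positivity
      have h8 : 0 ≤ r ^ 2 * x := by positivity
      nlinarith
    have hq : (0:ℝ) ≤ (q:ℝ) + 1 := by positivity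
    have key : C * ((r ^ 2 + 2 * g * s + g ^ 2) * (x + z))
        + (q + 1) * (4 * s ^ 2 * x + 2 * (g * s) * x) + r ^ 2 * x
        ≤ (4 * C + 8 * (q + 1) + 2) * (x * r ^ 2 + z * g ^ 2) := by
      have := mul_le_mul_of_nonneg_left b1 hC
      have := mul_le_mul_of_nonneg_left b2 hq
      linarith
    have := mul_le_mul_of_nonneg_left key (sq_nonneg g)
    linear_combination this

/-- Truncation at level `T`: for `w > T` the left-hand side is nonpositive. -/
lemma pow_div_sub_le_pow_mul_min {w T : ℝ} (hw : 0 ≤ w) (hT : 1 ≤ T) (q M : ℕ) :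
    w ^ (q + 1) / T - w ^ (q + 1 + M) / T ^ (M + 1) ≤ w ^ q * min 1 w := by
  have hT0 : 0 < T := by linarith
  have hq : 0 ≤ w ^ q := by positivity
  rcases le_total w T with hwT | hwT
  · have h1 : w / T ≤ min 1 w := le_min ((div_le_one hT0).2 hwT) (div_le_self hw hT)
    have h2 : 0 ≤ w ^ (q + 1 + M) / T ^ (M + 1) := by positivity
    have h3 := mul_le_mul_of_nonneg_left h1 hq
    rw [← mul_div_assoc, ← pow_succ] at h3
    linarith
  · have h1 : w ^ (q + 1) / T ≤ w ^ (q + 1 + M) / T ^ (M + 1) := by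
      rw [pow_add w (q + 1), pow_succ' T, ← div_mul_div_comm]
      refine le_mul_of_one_le_right (by positivity) ?_
      rw [one_le_div (by positivity)]
      exact pow_le_pow_left₀ hT0.le hwT M
    have h2 : 0 ≤ w ^ q * min 1 w := mul_nonneg hq (le_min zero_le_one hw)
    linarith

/-! ### The drift towards the median -/

lemma norm_inv_norm_smul_le_one {E : Type*} [NormedAddCommGroup E] [NormedSpace ℝ E] (x : E) :
    ‖‖x‖⁻¹ • x‖ ≤ 1 := by
  rw [norm_smul, norm_inv, norm_norm]
  exact inv_mul_le_one

section Drift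

variable {Ω H : Type*} [MeasurableSpace Ω] [NormedAddCommGroup H] [InnerProductSpace ℝ H]

/-- If `d ⟂ v`, the component of `y` along `d` is at most the norm of the component of `y`
orthogonal to `v`, which the Gram determinant of `y` and `v` measures. -/
lemma sq_norm_mul_sq_inner_le {y v d : H} (hd : inner ℝ v d = 0) :
    ‖v‖ ^ 2 * inner ℝ y d ^ 2 ≤ (‖y‖ ^ 2 * ‖v‖ ^ 2 - inner ℝ y v ^ 2) * ‖d‖ ^ 2 := by
  rcases eq_or_ne v 0 with rfl | hv
  · simp
  have hV : 0 < ‖v‖ ^ 2 := by positivity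
  have h1 : inner ℝ (‖v‖ ^ 2 • y - inner ℝ y v • v) d = ‖v‖ ^ 2 * inner ℝ y d := by
    rw [inner_sub_left, inner_smul_left, inner_smul_left, hd]
    simp
  have h2 : ‖‖v‖ ^ 2 • y - inner ℝ y v • v‖ ^ 2
      = ‖v‖ ^ 2 * (‖y‖ ^ 2 * ‖v‖ ^ 2 - inner ℝ y v ^ 2) := by
    rw [norm_sub_sq_real, norm_smul, norm_smul, inner_smul_left, inner_smul_right]
    simp only [norm_pow, mul_pow, Real.norm_eq_abs, sq_abs, conj_trivial]
    ring
  have h3 := abs_real_inner_le_norm (‖v‖ ^ 2 • y - inner ℝ y v • v) d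
  have h4 := sq_le_sq' (by linarith [neg_le_of_abs_le h3]) (le_of_abs_le h3)
  rw [h1, mul_pow, mul_pow, h2] at h4
  refine le_of_mul_le_mul_left ?_ hV
  linear_combination h4

/-- Strengthened subgradient inequality for the norm: the defect is controlled from below by the
component of `y` along a direction `d` orthogonal to `v`. The conventions `0⁻¹ = 0` and `x / 0 = 0`
make it hold for `y = v` and for `d = 0` as well. -/
lemma inner_unit_le (y v d : H) (hd : inner ℝ v d = 0) :
    inner ℝ v (‖y - v‖⁻¹ • (y - v)) ≤ ‖y‖ - ‖y - v‖
      - min 1 (‖v‖ ^ 2) * (((1 + ‖y‖) ^ 3)⁻¹ * inner ℝ y d ^ 2) / (2 * ‖d‖ ^ 2) := by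
  rcases eq_or_ne y v with rfl | hyv
  · simp [hd]
  rcases eq_or_ne y 0 with rfl | hy
  · simp only [zero_sub, norm_neg, smul_neg, inner_neg_right, inner_smul_right, inner_zero_left,
      norm_zero, real_inner_self_eq_norm_sq]
    have hv : ‖v‖ ≠ 0 := norm_ne_zero_iff.2 (Ne.symm hyv)
    field_simp
    simp
  rcases eq_or_ne d 0 with rfl | hd0
  · simp only [norm_zero]
    have h1 : inner ℝ v (y - v) = inner ℝ y (y - v) - ‖y - v‖ ^ 2 := by
      rw [← real_inner_self_eq_norm_sq, ← inner_sub_left]; simp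
    have hN : 0 < ‖y - v‖ := norm_pos_iff.2 (sub_ne_zero.2 hyv)
    have h2 := real_inner_le_norm y (y - v)
    rw [inner_smul_right, h1, inv_mul_le_iff₀ hN]
    norm_num
    nlinarith
  have hN : 0 < ‖y - v‖ := norm_pos_iff.2 (sub_ne_zero.2 hyv)
  have hR : 0 < ‖y‖ := norm_pos_iff.2 hy
  have hD : 0 < ‖d‖ := norm_pos_iff.2 hd0
  have hV : 0 ≤ ‖v‖ := norm_nonneg v
  have h1 : inner ℝ v (y - v) = inner ℝ y (y - v) - ‖y - v‖ ^ 2 := by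
    rw [← real_inner_self_eq_norm_sq, ← inner_sub_left]; simp
  have hgram := sq_norm_mul_sq_inner_le (y := y) hd
  have h2 : ‖y‖ ^ 2 * ‖y - v‖ ^ 2 - inner ℝ y (y - v) ^ 2
      = ‖y‖ ^ 2 * ‖v‖ ^ 2 - inner ℝ y v ^ 2 := by
    rw [norm_sub_sq_real, inner_sub_right, real_inner_self_eq_norm_sq]; ring
  have ht := real_inner_le_norm y (y - v)
  have htri : ‖y - v‖ ≤ ‖y‖ + ‖v‖ := norm_sub_le y v
  rw [← h2] at hgram
  rw [inner_smul_right, h1]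
  generalize inner ℝ y (y - v) = t at *
  generalize inner ℝ y d = f at *
  generalize ‖y - v‖ = N at *
  generalize ‖y‖ = R at *
  generalize ‖v‖ = V at *
  generalize ‖d‖ = D at *
  have hmin : min 1 (V ^ 2) * N ^ 2 ≤ V ^ 2 * (1 + R) ^ 2 := by
    rcases le_total 1 V with hle | hle
    · rw [min_eq_left (by nlinarith), ← mul_pow, one_mul]
      exact pow_le_pow_left₀ hN.le (by nlinarith) 2
    · rw [min_eq_right (by nlinarith)]
      exact mul_le_mul_of_nonneg_left (pow_le_pow_left₀ hN.le (by linarith) 2) (sq_nonneg V)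
  have hmin0 : 0 ≤ min 1 (V ^ 2) := le_min zero_le_one (sq_nonneg V)
  have h3 : R ^ 2 * N ^ 2 - t ^ 2 ≤ 2 * (R * N) * (R * N - t) := by nlinarith [sq_nonneg (R * N - t)]
  have h4 : min 1 (V ^ 2) * f ^ 2 / D ^ 2 / (1 + R) ^ 3 ≤ 2 * (R - t / N) := by
    rw [div_div, div_le_iff₀ (by positivity)]
    have h5 : V ^ 2 * f ^ 2 ≤ 2 * (R * N) * (R * N - t) * D ^ 2 :=
      hgram.trans (mul_le_mul_of_nonneg_right h3 (sq_nonneg D))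
    have h6 : R - t / N = (R * N - t) / N := by field_simp
    have h7 : 0 ≤ R * N - t := by linarith
    rw [h6]
    -- It is enough to compare after multiplication by `R * N ^ 2`.
    have h8 : min 1 (V ^ 2) * f ^ 2 * (R * N ^ 2) ≤
        2 * ((R * N - t) / N) * (D ^ 2 * (1 + R) ^ 3) * (R * N ^ 2) := by
      calc min 1 (V ^ 2) * f ^ 2 * (R * N ^ 2) = (min 1 (V ^ 2) * N ^ 2) * (f ^ 2 * R) := by ring
        _ ≤ (V ^ 2 * (1 + R) ^ 2) * (f ^ 2 * R) := by gcongr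
        _ = (V ^ 2 * f ^ 2) * ((1 + R) ^ 2 * R) := by ring
        _ ≤ (2 * (R * N) * (R * N - t) * D ^ 2) * ((1 + R) ^ 2 * (1 + R)) := by
          have : R ≤ 1 + R := by linarith
          have h9 : 0 ≤ 2 * (R * N) * (R * N - t) * D ^ 2 := by positivity
          gcongr
        _ = 2 * ((R * N - t) / N) * (D ^ 2 * (1 + R) ^ 3) * (R * N ^ 2) := by
          field_simp
    exact le_of_mul_le_mul_right h8 (by positivity)
  have e1 : N⁻¹ * (t - N ^ 2) = t / N - N := by field_simp
  have e2 : min 1 (V ^ 2) * (((1 + R) ^ 3)⁻¹ * f ^ 2) / (2 * D ^ 2)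
      = min 1 (V ^ 2) * f ^ 2 / D ^ 2 / (1 + R) ^ 3 / 2 := by field_simp
  rw [e1, e2]
  linarith

lemma weight_mul_norm_sq_le {E : Type*} [NormedAddCommGroup E] (y : E) : ((1 + ‖y‖) ^ 3)⁻¹ * ‖y‖ ^ 2 ≤ 1 := by
  rw [inv_mul_le_iff₀ (by positivity)]
  have := norm_nonneg y
  nlinarith [pow_nonneg this 3]

variable [MeasurableSpace H] [BorelSpace H] [SecondCountableTopology H]

lemma integrable_weight_mul_inner_mul_inner {P : Measure Ω} [IsFiniteMeasure P] {Y : Ω → H}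
    (hY : Measurable Y) (a b : H) :
    Integrable (fun ω => ((1 + ‖Y ω‖) ^ 3)⁻¹ * (inner ℝ (Y ω) a * inner ℝ (Y ω) b)) P := by
  refine Integrable.of_bound (by fun_prop) (‖a‖ * ‖b‖) (.of_forall fun ω => ?_)
  rw [norm_mul, norm_mul, Real.norm_of_nonneg (by positivity)]
  calc ((1 + ‖Y ω‖) ^ 3)⁻¹ * (‖inner ℝ (Y ω) a‖ * ‖inner ℝ (Y ω) b‖)
      ≤ ((1 + ‖Y ω‖) ^ 3)⁻¹ * ((‖Y ω‖ * ‖a‖) * (‖Y ω‖ * ‖b‖)) := by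
        gcongr <;> exact norm_inner_le_norm _ _
    _ = (((1 + ‖Y ω‖) ^ 3)⁻¹ * ‖Y ω‖ ^ 2) * (‖a‖ * ‖b‖) := by ring
    _ ≤ ‖a‖ * ‖b‖ := mul_le_of_le_one_left (by positivity) (weight_mul_norm_sq_le _)

lemma integrable_weight_mul_sq_inner {P : Measure Ω} [IsFiniteMeasure P] {Y : Ω → H}
    (hY : Measurable Y) (a : H) :
    Integrable (fun ω => ((1 + ‖Y ω‖) ^ 3)⁻¹ * inner ℝ (Y ω) a ^ 2) P := by
  simpa only [sq (inner ℝ _ _)] using integrable_weight_mul_inner_mul_inner hY a a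

lemma integral_weight_mul_sq_inner_pos {P : Measure Ω} [IsProbabilityMeasure P] {X : Ω → H}
    (hX : Measurable X) (m b : H) (hb : 0 < evariance (fun ω => inner ℝ (X ω) b) P) :
    0 < ∫ ω, ((1 + ‖X ω - m‖) ^ 3)⁻¹ * inner ℝ (X ω - m) b ^ 2 ∂P := by
  have hi := integrable_weight_mul_sq_inner (P := P) (hX.sub_const m) b
  refine lt_of_le_of_ne (integral_nonneg fun ω => by positivity) fun h0 => hb.ne' ?_
  have h1 := (integral_eq_zero_iff_of_nonneg (fun ω => by positivity) hi).1 h0.symm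
  rw [evariance_congr (Y := fun _ => inner ℝ m b), evariance_eq_zero_iff (by fun_prop)]
  · simp
  · filter_upwards [h1] with ω hω
    have hw : ((1 + ‖X ω - m‖) ^ 3)⁻¹ ≠ 0 := by positivity
    have : inner ℝ (X ω - m) b = 0 := by simpa [hw] using hω
    rwa [inner_sub_left, sub_eq_zero] at this

/-- The weighted second moment form `S(a, b) = E[⟪Y, a⟫ ⟪Y, b⟫ / (1 + ‖Y‖) ^ 3]` of `Y = X - m` has
two `S`-orthogonal vectors at which it is positive. The weight makes `S` finite without any moment
assumption on `X`. -/
lemma exists_weight_orthogonal_pair [CompleteSpace H] {P : Measure Ω} [IsProbabilityMeasure P]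
    {X : Ω → H} (hX : Measurable X) (hA1 : NotConcentratedOnLine P X) (m : H) :
    ∃ a b : H, 0 < ∫ ω, ((1 + ‖X ω - m‖) ^ 3)⁻¹ * inner ℝ (X ω - m) a ^ 2 ∂P ∧
      0 < ∫ ω, ((1 + ‖X ω - m‖) ^ 3)⁻¹ * inner ℝ (X ω - m) b ^ 2 ∂P ∧
      ∫ ω, ((1 + ‖X ω - m‖) ^ 3)⁻¹ * (inner ℝ (X ω - m) a * inner ℝ (X ω - m) b) ∂P = 0 := by
  obtain ⟨a, -, ha⟩ := hA1 0
  have hint : Integrable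
      (fun ω => (((1 + ‖X ω - m‖) ^ 3)⁻¹ * inner ℝ (X ω - m) a) • (X ω - m)) P := by
    refine Integrable.of_bound (by fun_prop) ‖a‖ (.of_forall fun ω => ?_)
    rw [norm_smul, norm_mul, Real.norm_of_nonneg (by positivity)]
    calc ((1 + ‖X ω - m‖) ^ 3)⁻¹ * ‖inner ℝ (X ω - m) a‖ * ‖X ω - m‖
        ≤ ((1 + ‖X ω - m‖) ^ 3)⁻¹ * (‖X ω - m‖ * ‖a‖) * ‖X ω - m‖ := by
          gcongr; exact norm_inner_le_norm _ _
      _ = (((1 + ‖X ω - m‖) ^ 3)⁻¹ * ‖X ω - m‖ ^ 2) * ‖a‖ := by ring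
      _ ≤ ‖a‖ := mul_le_of_le_one_left (norm_nonneg a) (weight_mul_norm_sq_le _)
  -- `b` is chosen orthogonal to the Bochner integral representing `S(a, ·)`.
  obtain ⟨b, hSb, hb⟩ := hA1 (∫ ω, (((1 + ‖X ω - m‖) ^ 3)⁻¹ * inner ℝ (X ω - m) a) • (X ω - m) ∂P)
  refine ⟨a, b, integral_weight_mul_sq_inner_pos hX m a ha,
    integral_weight_mul_sq_inner_pos hX m b hb, ?_⟩
  rw [real_inner_comm, ← integral_inner hint b] at hSb
  rw [← hSb]
  refine integral_congr_ae (.of_forall fun ω => ?_)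
  simp only [inner_smul_right, real_inner_comm b]
  ring

/-- Orthogonally to any `v` there is a direction in which the weighted second moment of `X - m` is
bounded below, uniformly in `v`: the plane spanned by the two vectors of
`exists_weight_orthogonal_pair` meets the hyperplane `v⊥`. -/
lemma exists_orthogonal_weight_ge [CompleteSpace H] {P : Measure Ω} [IsProbabilityMeasure P]
    {X : Ω → H} (hX : Measurable X) (hA1 : NotConcentratedOnLine P X) (m : H) :
    ∃ c : ℝ, 0 < c ∧ ∀ v : H, ∃ d : H, d ≠ 0 ∧ inner ℝ v d = 0 ∧
      c * ‖d‖ ^ 2 ≤ ∫ ω, ((1 + ‖X ω - m‖) ^ 3)⁻¹ * inner ℝ (X ω - m) d ^ 2 ∂P := by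
  obtain ⟨a, b, hA, hB, hab⟩ := exists_weight_orthogonal_pair hX hA1 m
  have hYm : Measurable fun ω => X ω - m := hX.sub_const m
  have key : ∀ s t : ℝ, ∫ ω, ((1 + ‖X ω - m‖) ^ 3)⁻¹ * inner ℝ (X ω - m) (s • a + t • b) ^ 2 ∂P
      = s ^ 2 * ∫ ω, ((1 + ‖X ω - m‖) ^ 3)⁻¹ * inner ℝ (X ω - m) a ^ 2 ∂P
        + t ^ 2 * ∫ ω, ((1 + ‖X ω - m‖) ^ 3)⁻¹ * inner ℝ (X ω - m) b ^ 2 ∂P := by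
    intro s t
    have h1 := (integrable_weight_mul_sq_inner (P := P) hYm a).const_mul (s ^ 2)
    have h2 := (integrable_weight_mul_sq_inner (P := P) hYm b).const_mul (t ^ 2)
    have h3 := (integrable_weight_mul_inner_mul_inner (P := P) hYm a b).const_mul (2 * s * t)
    have e : ∀ ω, ((1 + ‖X ω - m‖) ^ 3)⁻¹ * inner ℝ (X ω - m) (s • a + t • b) ^ 2
        = s ^ 2 * (((1 + ‖X ω - m‖) ^ 3)⁻¹ * inner ℝ (X ω - m) a ^ 2)
          + t ^ 2 * (((1 + ‖X ω - m‖) ^ 3)⁻¹ * inner ℝ (X ω - m) b ^ 2)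
          + 2 * s * t * (((1 + ‖X ω - m‖) ^ 3)⁻¹ *
            (inner ℝ (X ω - m) a * inner ℝ (X ω - m) b)) := fun ω => by
      rw [inner_add_right, inner_smul_right, inner_smul_right]; ring
    simp_rw [e]
    have e1 := integral_add (h1.add h2) h3
    simp only [Pi.add_apply] at e1
    rw [e1, integral_add h1 h2, integral_const_mul, integral_const_mul, integral_const_mul, hab,
      mul_zero, add_zero]
  set A := ∫ ω, ((1 + ‖X ω - m‖) ^ 3)⁻¹ * inner ℝ (X ω - m) a ^ 2 ∂P
  set B := ∫ ω, ((1 + ‖X ω - m‖) ^ 3)⁻¹ * inner ℝ (X ω - m) b ^ 2 ∂P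
  have hmin : 0 < min A B := lt_min hA hB
  -- The summand `1` below only serves to make positivity of the denominator evident.
  have hL : 0 < 2 * (‖a‖ ^ 2 + ‖b‖ ^ 2) + 1 := by positivity
  refine ⟨min A B / (2 * (‖a‖ ^ 2 + ‖b‖ ^ 2) + 1), by positivity, fun v => ?_⟩
  obtain ⟨s, t, hst, horth⟩ : ∃ s t : ℝ, 0 < s ^ 2 + t ^ 2 ∧ inner ℝ v (s • a + t • b) = 0 := by
    by_cases h : inner ℝ v a = 0
    · exact ⟨1, 0, by norm_num, by simpa using h⟩
    · refine ⟨inner ℝ v b, -inner ℝ v a, by rw [neg_sq]; positivity, ?_⟩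
      rw [inner_add_right, inner_smul_right, inner_smul_right]; ring
  have hge : min A B * (s ^ 2 + t ^ 2) ≤ s ^ 2 * A + t ^ 2 * B := by
    nlinarith [min_le_left A B, min_le_right A B, sq_nonneg s, sq_nonneg t]
  have hpos : 0 < min A B * (s ^ 2 + t ^ 2) := by positivity
  refine ⟨s • a + t • b, ?_, horth, ?_⟩
  · intro h0
    have := key s t
    rw [h0] at this
    simp only [inner_zero_right] at this
    norm_num at this
    linarith
  · rw [key, div_mul_eq_mul_div, div_le_iff₀ hL]
    have hn : ‖s • a + t • b‖ ^ 2 ≤ (s ^ 2 + t ^ 2) * (2 * (‖a‖ ^ 2 + ‖b‖ ^ 2) + 1) := by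
      have h1 : ‖s • a + t • b‖ ≤ |s| * ‖a‖ + |t| * ‖b‖ := by
        simpa [norm_smul] using norm_add_le (s • a) (t • b)
      have h2 := pow_le_pow_left₀ (norm_nonneg _) h1 2
      have h3 : (|s| * ‖a‖ + |t| * ‖b‖) ^ 2 ≤ 2 * (s ^ 2 * ‖a‖ ^ 2 + t ^ 2 * ‖b‖ ^ 2) := by
        have := add_sq_le (a := |s| * ‖a‖) (b := |t| * ‖b‖)
        simpa only [mul_pow, sq_abs] using this
      have h4 : 0 ≤ s ^ 2 * ‖b‖ ^ 2 := by positivity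
      have h5 : 0 ≤ t ^ 2 * ‖a‖ ^ 2 := by positivity
      linarith
    calc min A B * ‖s • a + t • b‖ ^ 2
        ≤ min A B * ((s ^ 2 + t ^ 2) * (2 * (‖a‖ ^ 2 + ‖b‖ ^ 2) + 1)) := by gcongr
      _ = min A B * (s ^ 2 + t ^ 2) * (2 * (‖a‖ ^ 2 + ‖b‖ ^ 2) + 1) := by ring
      _ ≤ _ := by gcongr

/-- The mean step of the algorithm at `h` points towards the median, with a strength that is
uniform over the whole space. -/
lemma exists_drift [CompleteSpace H] {P : Measure Ω} [IsProbabilityMeasure P] {X : Ω → H}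
    (hX : Measurable X) (hA1 : NotConcentratedOnLine P X) {m : H}
    (hm : IsGeometricMedian P X m) :
    ∃ c : ℝ, 0 < c ∧ ∀ h : H,
      ∫ ω, inner ℝ (h - m) (‖X ω - h‖⁻¹ • (X ω - h)) ∂P ≤ -(c * min 1 (‖h - m‖ ^ 2)) := by
  obtain ⟨c, hc, hd⟩ := exists_orthogonal_weight_ge hX hA1 m
  refine ⟨c / 2, by positivity, fun h => ?_⟩
  obtain ⟨d, hd0, horth, hcd⟩ := hd (h - m)
  have hobj : ∀ k : H, Integrable (fun ω => ‖X ω - k‖ - ‖X ω‖) P := fun k => by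
    refine Integrable.of_bound (by fun_prop) ‖k‖ (.of_forall fun ω => ?_)
    simpa using abs_norm_sub_norm_le (X ω - k) (X ω)
  have hw := integrable_weight_mul_sq_inner (P := P) (hX.sub_const m) d
  have hD : 0 < ‖d‖ ^ 2 := by have := norm_pos_iff.2 hd0; positivity
  have hpt : ∀ ω, inner ℝ (h - m) (‖X ω - h‖⁻¹ • (X ω - h)) ≤
      ((‖X ω - m‖ - ‖X ω‖) - (‖X ω - h‖ - ‖X ω‖))
        - min 1 (‖h - m‖ ^ 2) / (2 * ‖d‖ ^ 2) *
          (((1 + ‖X ω - m‖) ^ 3)⁻¹ * inner ℝ (X ω - m) d ^ 2) := fun ω => by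
    have := inner_unit_le (X ω - m) (h - m) d horth
    rw [sub_sub_sub_cancel_right] at this
    refine this.trans (le_of_eq ?_)
    ring
  have hl : Integrable (fun ω => inner ℝ (h - m) (‖X ω - h‖⁻¹ • (X ω - h))) P := by
    refine Integrable.of_bound (by fun_prop) ‖h - m‖ (.of_forall fun ω => ?_)
    refine (norm_inner_le_norm _ _).trans (mul_le_of_le_one_right (norm_nonneg _) ?_)
    rw [norm_smul, norm_inv, norm_norm]
    exact inv_mul_le_one
  refine (integral_mono hl (((hobj m).sub (hobj h)).sub (hw.const_mul _)) hpt).trans ?_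
  have e := integral_sub ((hobj m).sub (hobj h))
    (hw.const_mul (min 1 (‖h - m‖ ^ 2) / (2 * ‖d‖ ^ 2)))
  have e' := integral_sub (hobj m) (hobj h)
  simp only [Pi.sub_apply] at e ⊢
  rw [e, e', integral_const_mul]
  have hmh := hm h
  rw [medianObjective, medianObjective] at hmh
  have hmin : 0 ≤ min 1 (‖h - m‖ ^ 2) := le_min zero_le_one (sq_nonneg _)
  have h5 := mul_le_mul_of_nonneg_left hcd
    (by positivity : 0 ≤ min 1 (‖h - m‖ ^ 2) / (2 * ‖d‖ ^ 2))
  have e5 : min 1 (‖h - m‖ ^ 2) / (2 * ‖d‖ ^ 2) * (c * ‖d‖ ^ 2)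
      = c / 2 * min 1 (‖h - m‖ ^ 2) := by field_simp
  linarith

end Drift

/-! ### Independence of the estimator and the next observation -/

lemma ProbabilityTheory.IndepFun.prodMk_left_of_prodMk_right {Ω α β γ : Type*} [MeasurableSpace Ω]
    [MeasurableSpace α] [MeasurableSpace β] [MeasurableSpace γ] {P : Measure Ω}
    [IsProbabilityMeasure P] {A : Ω → α} {B : Ω → β} {C : Ω → γ} (hA : Measurable A)
    (hB : Measurable B) (hC : Measurable C) (h : IndepFun A (fun ω => (B ω, C ω)) P)
    (hBC : IndepFun B C P) : IndepFun (fun ω => (A ω, B ω)) C P := by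
  have hAB : IndepFun A B P := h.comp measurable_id measurable_fst
  have := Measure.isProbabilityMeasure_map (μ := P) hA.aemeasurable
  have := Measure.isProbabilityMeasure_map (μ := P) hB.aemeasurable
  have := Measure.isProbabilityMeasure_map (μ := P) hC.aemeasurable
  rw [indepFun_iff_map_prod_eq_prod_map_map (by fun_prop) (by fun_prop)] at h hAB hBC ⊢
  rw [hBC, ← Measure.prodAssoc_prod] at h
  rw [hAB]
  apply (MeasurableEquiv.prodAssoc (α := α) (β := β) (γ := γ)).map_measurableEquiv_injective
  rw [← h, Measure.map_map (by fun_prop) (by fun_prop)]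
  rfl

lemma ProbabilityTheory.iIndepFun.indepFun_tail {Ω H : Type*} [MeasurableSpace Ω]
    [MeasurableSpace H] {P : Measure Ω} {X : ℕ → Ω → H} (hX : ∀ n, Measurable (X n))
    (h : iIndepFun X P) (n : ℕ) : IndepFun (X n) (fun ω (k : ℕ) => X (n + 1 + k) ω) P := by
  have h1 := indep_iSup_of_disjoint (fun i => (hX i).comap_le) h.iIndep
    (Set.disjoint_left.2 fun i (hi : i = n) (hi' : n < i) => hi'.ne hi.symm :
      Disjoint {i | i = n} {i | n < i})
  rw [IndepFun_iff_Indep]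
  refine indep_of_indep_of_le_left (indep_of_indep_of_le_right h1 ?_) ?_
  · rw [MeasurableSpace.pi, MeasurableSpace.comap_iSup]
    refine iSup_le fun k => ?_
    rw [MeasurableSpace.comap_comp]
    exact le_iSup₂_of_le (n + 1 + k) (show n < n + 1 + k by omega) le_rfl
  · exact le_iSup₂_of_le n rfl le_rfl

section RobbinsMonro

variable {Ω H : Type*} [MeasurableSpace Ω] [NormedAddCommGroup H] [InnerProductSpace ℝ H]
  [MeasurableSpace H]

lemma IsRobbinsMonro.ae_bounded {P : Measure Ω} {Xs : ℕ → Ω → H} {γ : ℕ → ℝ} {Z : ℕ → Ω → H}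
    (hZ : IsRobbinsMonro P Xs γ Z) (m : H) {n : ℕ} (hn : 1 ≤ n) :
    ∃ B : ℝ, ∀ᵐ ω ∂P, ‖Z n ω - m‖ ≤ B := by
  induction n, hn using Nat.le_induction with
  | base =>
    obtain ⟨M, hM⟩ := hZ.bounded_init
    refine ⟨M + ‖m‖, ?_⟩
    filter_upwards [hM] with ω hω
    exact (norm_sub_le _ _).trans (by gcongr)
  | succ n hn ih =>
    obtain ⟨B, hB⟩ := ih
    refine ⟨B + |γ n|, ?_⟩
    filter_upwards [hB] with ω hω
    rw [hZ.step n hn, add_sub_right_comm]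
    refine (norm_add_le _ _).trans (add_le_add hω ?_)
    rw [norm_smul]
    exact mul_le_of_le_one_right (norm_nonneg _) (norm_inv_norm_smul_le_one _)

variable [BorelSpace H] [SecondCountableTopology H]

/-- The estimator `Z n` is independent of the whole sequence of later observations. Keeping the
whole tail is what makes the induction go through. -/
lemma IsRobbinsMonro.measurable_and_indepFun_tail {P : Measure Ω} [IsProbabilityMeasure P] {Xs : ℕ → Ω → H}
    {γ : ℕ → ℝ} {Z : ℕ → Ω → H} (hZ : IsRobbinsMonro P Xs γ Z)
    (hXs_meas : ∀ n : ℕ, 1 ≤ n → Measurable (Xs n))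
    (hXs_indep : iIndepFun (fun k : ℕ => Xs (k + 1)) P) {n : ℕ} (hn : 1 ≤ n) :
    Measurable (Z n) ∧ IndepFun (Z n) (fun ω (k : ℕ) => Xs (n + 1 + k) ω) P := by
  induction n, hn using Nat.le_induction with
  | base =>
    refine ⟨hZ.measurable_init, ?_⟩
    convert hZ.indep_init using 4
    omega
  | succ n hn ih =>
    obtain ⟨hmeas, hind⟩ := ih
    have hX := hXs_meas (n + 1) (by omega)
    have htail : Measurable fun ω (k : ℕ) => Xs (n + 1 + 1 + k) ω :=
      measurable_pi_lambda _ fun k => hXs_meas _ (by omega)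
    have hstep : Z (n + 1) = (fun zx : H × H =>
        zx.1 + γ n • (‖zx.2 - zx.1‖⁻¹ • (zx.2 - zx.1))) ∘ fun ω => (Z n ω, Xs (n + 1) ω) := by
      funext ω
      exact hZ.step n hn ω
    have hphi : Measurable fun zx : H × H =>
        zx.1 + γ n • (‖zx.2 - zx.1‖⁻¹ • (zx.2 - zx.1)) := by fun_prop
    refine ⟨hstep ▸ hphi.comp (hmeas.prodMk hX), ?_⟩
    have h1 : IndepFun (Z n) (fun ω => (Xs (n + 1) ω, fun k : ℕ => Xs (n + 1 + 1 + k) ω)) P := by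
      have hpsi : Measurable fun x : ℕ → H => (x 0, fun k : ℕ => x (k + 1)) :=
        (measurable_pi_apply 0).prodMk (measurable_pi_lambda _ fun k => measurable_pi_apply (k + 1))
      have h2 := hind.comp measurable_id hpsi
      convert h2 using 1
      · rfl
      · funext ω
        simp only [Function.comp, Nat.add_zero, Nat.add_assoc, Nat.add_comm 1]
    have h3 : IndepFun (Xs (n + 1)) (fun ω (k : ℕ) => Xs (n + 1 + 1 + k) ω) P := by
      convert hXs_indep.indepFun_tail (fun k => hXs_meas (k + 1) (by omega)) n using 4
      omega
    rw [hstep]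
    exact (h1.prodMk_left_of_prodMk_right hmeas hX htail h3).comp hphi measurable_id

/-! ### Moments of the estimator -/

lemma integrable_norm_sub_sq_pow {Ω E : Type*} [MeasurableSpace Ω] [NormedAddCommGroup E]
    [MeasurableSpace E] [BorelSpace E] [SecondCountableTopology E] {P : Measure Ω} [IsProbabilityMeasure P] {Z : Ω → E}
    {m : E} (hZ : Measurable Z) {B : ℝ} (hB : ∀ᵐ ω ∂P, ‖Z ω - m‖ ≤ B) (q : ℕ) :
    Integrable (fun ω => (‖Z ω - m‖ ^ 2) ^ q) P := by
  refine Integrable.of_bound (by fun_prop) ((B ^ 2) ^ q) ?_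
  filter_upwards [hB] with ω hω
  simp only [norm_pow, norm_norm]
  gcongr

/-- The drift inequality, integrated with respect to the law of an independent position `Z`. -/
lemma integral_pow_mul_inner_le {P : Measure Ω} [IsProbabilityMeasure P] {X : Ω → H} {m : H}
    {c : ℝ} (hdrift : ∀ h : H,
      ∫ ω, inner ℝ (h - m) (‖X ω - h‖⁻¹ • (X ω - h)) ∂P ≤ -(c * min 1 (‖h - m‖ ^ 2)))
    {Z X' : Ω → H} (hZ : Measurable Z) (hX' : Measurable X') (hind : IndepFun Z X' P)
    (hlaw : IdentDistrib X' X P P) {B : ℝ} (hB : ∀ᵐ ω ∂P, ‖Z ω - m‖ ≤ B) (q : ℕ) :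
    ∫ ω, (‖Z ω - m‖ ^ 2) ^ q * inner ℝ (Z ω - m) (‖X' ω - Z ω‖⁻¹ • (X' ω - Z ω)) ∂P ≤
      -(c * ∫ ω, (‖Z ω - m‖ ^ 2) ^ q * min 1 (‖Z ω - m‖ ^ 2) ∂P) := by
  have := Measure.isProbabilityMeasure_map (μ := P) hZ.aemeasurable
  have := Measure.isProbabilityMeasure_map (μ := P) hX'.aemeasurable
  set F : H × H → ℝ := fun zx =>
    (‖zx.1 - m‖ ^ 2) ^ q * inner ℝ (zx.1 - m) (‖zx.2 - zx.1‖⁻¹ • (zx.2 - zx.1)) with hF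
  have hFm : Measurable F := by fun_prop
  have hjoint := (indepFun_iff_map_prod_eq_prod_map_map hZ.aemeasurable hX'.aemeasurable).1 hind
  have hFint : Integrable F ((P.map Z).prod (P.map X')) := by
    rw [← hjoint, integrable_map_measure hFm.aestronglyMeasurable (by fun_prop)]
    refine Integrable.of_bound (hFm.comp (hZ.prodMk hX')).aestronglyMeasurable ((B ^ 2) ^ q * B) ?_
    filter_upwards [hB] with ω hω
    have hB0 : 0 ≤ B := (norm_nonneg _).trans hω
    simp only [hF, Function.comp, norm_mul, norm_pow, norm_norm]
    gcongr
    refine (norm_inner_le_norm _ _).trans ((mul_le_of_le_one_right (norm_nonneg _) ?_).trans hω)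
    exact norm_inv_norm_smul_le_one _
  have e1 : ∫ ω, (‖Z ω - m‖ ^ 2) ^ q * inner ℝ (Z ω - m) (‖X' ω - Z ω‖⁻¹ • (X' ω - Z ω)) ∂P
      = ∫ zx, F zx ∂(P.map fun ω => (Z ω, X' ω)) := by
    rw [integral_map (by fun_prop) (by fun_prop)]
  rw [e1, hjoint, integral_prod _ hFint, ← integral_const_mul, ← integral_neg]
  have hinner : ∀ z, ∫ x, F (z, x) ∂(P.map X')
      ≤ -(c * ((‖z - m‖ ^ 2) ^ q * min 1 (‖z - m‖ ^ 2))) := fun z => by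
    have hFz : Measurable fun x => F (z, x) := hFm.comp measurable_prodMk_left
    rw [hlaw.map_eq, integral_map hlaw.aemeasurable_snd hFz.aestronglyMeasurable]
    simp only [hF]
    rw [integral_const_mul]
    have := mul_le_mul_of_nonneg_left (hdrift z) (by positivity : 0 ≤ (‖z - m‖ ^ 2) ^ q)
    linarith
  have hmin : Integrable (fun z => -(c * ((‖z - m‖ ^ 2) ^ q * min 1 (‖z - m‖ ^ 2)))) (P.map Z) := by
    refine Integrable.neg (Integrable.const_mul ?_ c)
    rw [integrable_map_measure (by fun_prop) (by fun_prop)]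
    refine Integrable.of_bound (by fun_prop) ((B ^ 2) ^ q * 1) ?_
    filter_upwards [hB] with ω hω
    have hmin0 : 0 ≤ min 1 (‖Z ω - m‖ ^ 2) := le_min zero_le_one (sq_nonneg _)
    simp only [Function.comp, norm_mul, norm_pow, norm_norm]
    rw [Real.norm_of_nonneg hmin0]
    gcongr
    exact min_le_left _ _
  refine (integral_mono hFint.integral_prod_left hmin hinner).trans (le_of_eq ?_)
  rw [integral_map (by fun_prop) (by fun_prop)]

lemma IsRobbinsMonro.exists_moment_recursion [CompleteSpace H] {P : Measure Ω} [IsProbabilityMeasure P]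
    {X : Ω → H} (hX : Measurable X) (hA1 : NotConcentratedOnLine P X) {m : H}
    (hm : IsGeometricMedian P X m) {Xs : ℕ → Ω → H}
    (hXs_meas : ∀ n : ℕ, 1 ≤ n → Measurable (Xs n))
    (hXs_indep : iIndepFun (fun k : ℕ => Xs (k + 1)) P)
    (hXs_law : ∀ n : ℕ, 1 ≤ n → IdentDistrib (Xs n) X P P)
    {γ : ℕ → ℝ} (hγ : ∀ n, 0 ≤ γ n) {Z : ℕ → Ω → H} (hZ : IsRobbinsMonro P Xs γ Z) :
    ∃ c : ℝ, 0 < c ∧ ∀ q : ℕ, ∃ C : ℝ, 0 ≤ C ∧ ∀ n : ℕ, 1 ≤ n →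
      ∫ ω, (‖Z (n + 1) ω - m‖ ^ 2) ^ (q + 1) ∂P ≤ ∫ ω, (‖Z n ω - m‖ ^ 2) ^ (q + 1) ∂P
        - 2 * (q + 1) * γ n * (c * ∫ ω, (‖Z n ω - m‖ ^ 2) ^ q * min 1 (‖Z n ω - m‖ ^ 2) ∂P)
        + C * γ n ^ 2 * (∫ ω, (‖Z n ω - m‖ ^ 2) ^ q ∂P + (γ n ^ 2) ^ q) := by
  obtain ⟨c, hc, hdrift⟩ := exists_drift hX hA1 hm
  refine ⟨c, hc, fun q => ?_⟩
  obtain ⟨C, hC, hpow⟩ := exists_quadratic_pow_succ_le q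
  refine ⟨C, hC, fun n hn => ?_⟩
  obtain ⟨hZm, hZi⟩ := hZ.measurable_and_indepFun_tail hXs_meas hXs_indep hn
  obtain ⟨hZm', -⟩ := hZ.measurable_and_indepFun_tail hXs_meas hXs_indep (hn.trans n.le_succ)
  obtain ⟨B, hB⟩ := hZ.ae_bounded m hn
  obtain ⟨B', hB'⟩ := hZ.ae_bounded m (hn.trans n.le_succ)
  have hXm := hXs_meas (n + 1) (by omega)
  have hind : IndepFun (Z n) (Xs (n + 1)) P :=
    hZi.comp (φ := id) (ψ := fun x : ℕ → H => x 0) measurable_id (by fun_prop)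
  set U : Ω → H := fun ω => ‖Xs (n + 1) ω - Z n ω‖⁻¹ • (Xs (n + 1) ω - Z n ω) with hU
  have hUm : Measurable U := by fun_prop
  have hU1 : ∀ ω, ‖U ω‖ ≤ 1 := fun ω => norm_inv_norm_smul_le_one _
  have hVU : ∀ ω, |inner ℝ (Z n ω - m) (U ω)| ≤ ‖Z n ω - m‖ := fun ω =>
    (abs_real_inner_le_norm _ _).trans (mul_le_of_le_one_right (norm_nonneg _) (hU1 ω))
  have hpt : ∀ ω, (‖Z (n + 1) ω - m‖ ^ 2) ^ (q + 1) ≤ (‖Z n ω - m‖ ^ 2) ^ (q + 1)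
      + 2 * (q + 1) * γ n * ((‖Z n ω - m‖ ^ 2) ^ q * inner ℝ (Z n ω - m) (U ω))
      + C * γ n ^ 2 * ((‖Z n ω - m‖ ^ 2) ^ q + (γ n ^ 2) ^ q) := fun ω => by
    have h1 := hpow ‖Z n ω - m‖ (γ n) (inner ℝ (Z n ω - m) (U ω)) (norm_nonneg _) (hγ n) (hVU ω)
    refine (pow_le_pow_left₀ (sq_nonneg _) ?_ (q + 1)).trans (h1.trans (le_of_eq (by ring)))
    rw [hZ.step n hn, add_sub_right_comm, norm_add_sq_real, inner_smul_right, norm_smul, mul_pow,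
      Real.norm_eq_abs, sq_abs]
    have h2 : ‖U ω‖ ^ 2 ≤ 1 := pow_le_one₀ (norm_nonneg _) (hU1 ω)
    have h3 := mul_le_mul_of_nonneg_left h2 (sq_nonneg (γ n))
    simp only [hU] at h3 ⊢
    linarith
  have i0 := integrable_norm_sub_sq_pow hZm' hB' (q + 1)
  have i1 := integrable_norm_sub_sq_pow hZm hB (q + 1)
  have i2 : Integrable (fun ω => (‖Z n ω - m‖ ^ 2) ^ q * inner ℝ (Z n ω - m) (U ω)) P := by
    refine Integrable.of_bound (by fun_prop) ((B ^ 2) ^ q * B) ?_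
    filter_upwards [hB] with ω hω
    have hB0 : 0 ≤ B := (norm_nonneg _).trans hω
    simp only [norm_mul, norm_pow, norm_norm]
    gcongr
    exact (hVU ω).trans hω
  have i3 := integrable_norm_sub_sq_pow hZm hB q
  have hint := integral_mono i0 ((i1.add (i2.const_mul (2 * (q + 1) * γ n))).add
    ((i3.add (integrable_const ((γ n ^ 2) ^ q))).const_mul (C * γ n ^ 2))) hpt
  have e1 := integral_add (i1.add (i2.const_mul (2 * (q + 1) * γ n)))
    ((i3.add (integrable_const ((γ n ^ 2) ^ q))).const_mul (C * γ n ^ 2))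
  have e2 := integral_add i1 (i2.const_mul (2 * (q + 1) * γ n))
  have e3 := integral_add i3 (integrable_const (μ := P) ((γ n ^ 2) ^ q))
  simp only [Pi.add_apply] at hint e1 e2 e3
  rw [e1, e2, integral_const_mul, integral_const_mul, e3, integral_const, probReal_univ,
    one_smul] at hint
  have hneg := integral_pow_mul_inner_le hdrift hZm hXm hind (hXs_law (n + 1) (by omega)) hB q
  have := mul_le_mul_of_nonneg_left hneg
    (by have := hγ n; positivity : (0:ℝ) ≤ 2 * (q + 1) * γ n)
  linarith

lemma IsRobbinsMonro.exists_moment_le [CompleteSpace H] {P : Measure Ω} [IsProbabilityMeasure P]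
    {X : Ω → H} (hX : Measurable X) (hA1 : NotConcentratedOnLine P X) {m : H}
    (hm : IsGeometricMedian P X m) {Xs : ℕ → Ω → H}
    (hXs_meas : ∀ n : ℕ, 1 ≤ n → Measurable (Xs n))
    (hXs_indep : iIndepFun (fun k : ℕ => Xs (k + 1)) P)
    (hXs_law : ∀ n : ℕ, 1 ≤ n → IdentDistrib (Xs n) X P P)
    {cγ α : ℝ} (hcγ : 0 < cγ) (hα : α ∈ Set.Ioo (1 / 2 : ℝ) 1) {Z : ℕ → Ω → H}
    (hZ : IsRobbinsMonro P Xs (fun n => cγ * (n : ℝ) ^ (-α)) Z) (q : ℕ) :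
    ∃ K : ℝ, 0 < K ∧ ∀ n : ℕ, 1 ≤ n →
      ∫ ω, (‖Z n ω - m‖ ^ 2) ^ q ∂P ≤ K * (n : ℝ) ^ (-(q * α)) := by
  have hγ : ∀ n : ℕ, 0 ≤ cγ * (n : ℝ) ^ (-α) := fun n => by positivity
  obtain ⟨c, hc, hrec⟩ :=
    exists_moment_recursion hX hA1 hm hXs_meas hXs_indep hXs_law hγ hZ
  refine exists_moment_rate (a := fun q n => ∫ ω, (‖Z n ω - m‖ ^ 2) ^ q ∂P) hcγ hα
    (fun q n => integral_nonneg fun ω => by positivity) (fun n => by simp) ?_ ?_ q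
  · intro q
    obtain ⟨C, hC, h⟩ := hrec q
    refine ⟨C, hC, fun n hn => (h n hn).trans ?_⟩
    have hmin : 0 ≤ ∫ ω, (‖Z n ω - m‖ ^ 2) ^ q * min 1 (‖Z n ω - m‖ ^ 2) ∂P :=
      integral_nonneg fun ω => mul_nonneg (by positivity) (le_min zero_le_one (sq_nonneg _))
    have := hγ n
    have : 0 ≤ 2 * (q + 1) * (cγ * (n : ℝ) ^ (-α)) *
      (c * ∫ ω, (‖Z n ω - m‖ ^ 2) ^ q * min 1 (‖Z n ω - m‖ ^ 2) ∂P) := by positivity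
    linarith
  · intro q
    obtain ⟨C, hC, h⟩ := hrec q
    refine ⟨2 * (q + 1) * c, by positivity, C, hC, fun n hn T hT M => (h n hn).trans ?_⟩
    obtain ⟨hZm, -⟩ := hZ.measurable_and_indepFun_tail hXs_meas hXs_indep hn
    obtain ⟨B, hB⟩ := hZ.ae_bounded m hn
    have i1 := (integrable_norm_sub_sq_pow hZm hB (q + 1)).div_const T
    have i2 := (integrable_norm_sub_sq_pow hZm hB (q + 1 + M)).div_const (T ^ (M + 1))
    have i3 : Integrable (fun ω => (‖Z n ω - m‖ ^ 2) ^ q * min 1 (‖Z n ω - m‖ ^ 2)) P := by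
      refine (integrable_norm_sub_sq_pow hZm hB q).mono' (by fun_prop) (.of_forall fun ω => ?_)
      have hmin0 : 0 ≤ min 1 (‖Z n ω - m‖ ^ 2) := le_min zero_le_one (sq_nonneg _)
      rw [Real.norm_of_nonneg (by positivity)]
      exact mul_le_of_le_one_right (by positivity) (min_le_left _ _)
    have hmono := integral_mono (i1.sub i2) i3
      fun ω => pow_div_sub_le_pow_mul_min (sq_nonneg ‖Z n ω - m‖) hT q M
    have e := integral_sub i1 i2
    simp only [Pi.sub_apply] at hmono e
    rw [e, integral_div, integral_div] at hmono
    have := mul_le_mul_of_nonneg_left hmono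
      (by have := hγ n; positivity : 0 ≤ 2 * (q + 1) * (cγ * (n : ℝ) ^ (-α)) * c)
    linarith

end RobbinsMonro

theorem theorem4p1 {Ω H : Type*} [MeasurableSpace Ω]
    [NormedAddCommGroup H] [InnerProductSpace ℝ H] [CompleteSpace H]
    [TopologicalSpace.SeparableSpace H] [MeasurableSpace H] [BorelSpace H]
    (P : Measure Ω) [IsProbabilityMeasure P]
    (X : Ω → H) (hX : Measurable X)
    (hA1 : NotConcentratedOnLine P X) (hA2 : NotConcentratedAroundPoints P X)
    (m : H) (hm : IsGeometricMedian P X m)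
    (Xs : ℕ → Ω → H) (hXs_meas : ∀ n : ℕ, 1 ≤ n → Measurable (Xs n))
    (hXs_indep : iIndepFun (fun k : ℕ => Xs (k + 1)) P)
    (hXs_law : ∀ n : ℕ, 1 ≤ n → IdentDistrib (Xs n) X P P)
    (cγ α : ℝ) (hcγ : 0 < cγ) (hα : α ∈ Set.Ioo (1 / 2 : ℝ) 1)
    (Z : ℕ → Ω → H) (hZ : IsRobbinsMonro P Xs (fun n => cγ * (n : ℝ) ^ (-α)) Z)
    (p : ℝ) (hp : 1 ≤ p) :
    ∃ K : ℝ, 0 < K ∧ ∀ n : ℕ, 1 ≤ n →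
      (Integrable (fun ω => ‖Z n ω - m‖ ^ (2 * p)) P ∧
        ∫ ω, ‖Z n ω - m‖ ^ (2 * p) ∂P ≤ K / (n : ℝ) ^ (p * α)) ∧
      (Integrable (fun ω => ‖Z n ω - m‖ ^ p) P ∧
        ∫ ω, ‖Z n ω - m‖ ^ p ∂P ≤ Real.sqrt K / (n : ℝ) ^ (p * α / 2)) := by
  have := UniformSpace.secondCountable_of_separable H
  obtain ⟨q, hq⟩ := exists_nat_ge p
  obtain ⟨K, hK, hKn⟩ := hZ.exists_moment_le hX hA1 hm hXs_meas hXs_indep hXs_law hcγ hα q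
  refine ⟨K + 1, by positivity, fun n hn => ?_⟩
  have hn0 : (0 : ℝ) < n := by exact_mod_cast hn
  obtain ⟨hZm, -⟩ := hZ.measurable_and_indepFun_tail hXs_meas hXs_indep hn
  obtain ⟨B, hB⟩ := hZ.ae_bounded m hn
  have hint : ∀ r : ℝ, 0 ≤ r → Integrable (fun ω => ‖Z n ω - m‖ ^ r) P := fun r hr => by
    refine Integrable.of_bound (by fun_prop) (B ^ r) ?_
    filter_upwards [hB] with ω hω
    rw [Real.norm_of_nonneg (by positivity)]
    gcongr
  have h2p := hint (2 * p) (by linarith)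
  have hp1 := hint p (by linarith)
  have hmain : ∫ ω, ‖Z n ω - m‖ ^ (2 * p) ∂P ≤ (K + 1) / (n : ℝ) ^ (p * α) := by
    -- With `x = n ^ α * ‖Z n - m‖ ^ 2`, integrate `x ^ p ≤ 1 + x ^ q`.
    have hpt : ∀ ω, ‖Z n ω - m‖ ^ (2 * p) * (n : ℝ) ^ (p * α) ≤
        1 + (‖Z n ω - m‖ ^ 2) ^ q * (n : ℝ) ^ (q * α) := fun ω => by
      have hx : 0 ≤ ‖Z n ω - m‖ ^ 2 * (n : ℝ) ^ α := by positivity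
      have e1 : ‖Z n ω - m‖ ^ (2 * p) * (n : ℝ) ^ (p * α)
          = (‖Z n ω - m‖ ^ 2 * (n : ℝ) ^ α) ^ p := by
        rw [Real.mul_rpow (by positivity) (by positivity), ← Real.rpow_mul hn0.le, mul_comm α,
          Real.rpow_mul (norm_nonneg _), Real.rpow_two]
      have e2 : (‖Z n ω - m‖ ^ 2) ^ q * (n : ℝ) ^ (q * α)
          = (‖Z n ω - m‖ ^ 2 * (n : ℝ) ^ α) ^ (q : ℝ) := by
        rw [Real.mul_rpow (by positivity) (by positivity), ← Real.rpow_mul hn0.le, mul_comm α,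
          Real.rpow_natCast]
      rw [e1, e2]
      rcases le_total (‖Z n ω - m‖ ^ 2 * (n : ℝ) ^ α) 1 with hle | hle
      · have := Real.rpow_le_one hx hle (by linarith : 0 ≤ p)
        have : 0 ≤ (‖Z n ω - m‖ ^ 2 * (n : ℝ) ^ α) ^ (q : ℝ) := by positivity
        linarith
      · have := Real.rpow_le_rpow_of_exponent_le hle hq
        linarith
    have hi := (integrable_norm_sub_sq_pow hZm hB q).mul_const ((n : ℝ) ^ (q * α))
    have h1 := integral_mono (h2p.mul_const _) ((integrable_const 1).add hi) hpt
    have e := integral_add (integrable_const (μ := P) (1 : ℝ)) hi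
    simp only [Pi.add_apply] at h1
    rw [e, integral_mul_const, integral_mul_const, integral_const, probReal_univ, one_smul] at h1
    rw [le_div_iff₀ (by positivity)]
    refine h1.trans ?_
    have h2 := mul_le_mul_of_nonneg_right (hKn n hn) (by positivity : 0 ≤ (n : ℝ) ^ (q * α))
    rw [mul_assoc, ← Real.rpow_add hn0, neg_add_cancel, Real.rpow_zero, mul_one] at h2
    linarith
  refine ⟨⟨h2p, hmain⟩, hp1, ?_⟩
  set s := Real.sqrt (K + 1) / (n : ℝ) ^ (p * α / 2) with hs
  have hs0 : 0 < s := by positivity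
  have hs2 : s ^ 2 = (K + 1) / (n : ℝ) ^ (p * α) := by
    rw [hs, div_pow, Real.sq_sqrt (by positivity), ← Real.rpow_mul_natCast hn0.le]
    congr 2
    push_cast; ring
  rw [← hs2] at hmain
  -- The arithmetic-geometric mean inequality `2 * s * x ≤ x ^ 2 + s ^ 2` replaces Cauchy–Schwarz.
  have hpt : ∀ ω, 2 * s * ‖Z n ω - m‖ ^ p ≤ ‖Z n ω - m‖ ^ (2 * p) + s ^ 2 := fun ω => by
    rw [mul_comm 2 p, Real.rpow_mul (norm_nonneg _), Real.rpow_two]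
    nlinarith [sq_nonneg (‖Z n ω - m‖ ^ p - s)]
  have h1 := integral_mono (hp1.const_mul _) (h2p.add (integrable_const (s ^ 2))) hpt
  have e := integral_add h2p (integrable_const (μ := P) (s ^ 2))
  simp only [Pi.add_apply] at h1
  rw [e, integral_const_mul, integral_const, probReal_univ, one_smul] at h1
  have h2 : 2 * s * ∫ ω, ‖Z n ω - m‖ ^ p ∂P ≤ 2 * s * s := by nlinarith
  exact le_of_mul_le_mul_left h2 (by positivity)
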